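/- **Definitions.** All probability spaces are taken to be complete (products carry the completed product $\sigma$-algebra, intervals the Lebesgue sets). A probability space is *standard* if it is isomorphic mod 0 to $[0,1]$ with Lebesgue measure, to a probability space on finitely or countably many atoms, or to a convex combination of both. A (one-period) *market* $M=((\Omega,\mathcal F,\mathbb P),c)$ is a probability space with a function $c:L^0(\Omega;\mathbb R)\to\mathbb R\cup\{\pm\infty\}$. A *morphism* $M_1\to M_2$ is an almost-sure equivalence class of measurable, measure-preserving maps $\phi:\Omega_1\to\Omega_2$ with $c_2(X)\ge c_1(X\circ\phi)$ for all $X\in L^0(\Omega_2;\mathbb R)$; an *isomorphism* is a morphism with a two-sided inverse morphism. For a measure $\mu$ and a measurable real function $f$, let $\mathbb E_\mu(f)=\int f^+\,d\mu-\int f^-\,d\mu$ if at least one of the two terms is finite, and $\mathbb E_\mu(f)=\infty$ otherwise. The market $M$ is *complete*, with pricing measure $\mathbb Q$ and constant $C$, if $\mathbb Q$ is a probability measure equivalent to $\mathbb P$, $C>0$, and $c(X)=C\,\mathbb E_{\mathbb Q}(X)$ for all $X\in L^0(\Omega;\mathbb R)$. The *casino* $I$ is the complete market on $[0,1)$ whose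 $\mathbb P$ and $\mathbb Q$ are both Lebesgue measure and whose constant is $1$. For a complete market $M$ with pricing measure $\mathbb Q$ and constant $C$, $M\times I$ is the complete market given by the products of the $\mathbb P$-measures and of the $\mathbb Q$-measures, with constant $C$. Let $F_{d\mathbb Q/d\mathbb P}$ be the distribution function of $\frac{d\mathbb Q}{d\mathbb P}$ under $\mathbb P$ and $F^{-1}_{d\mathbb Q/d\mathbb P}(p)=\inf\{x\in\mathbb R: p\le F_{d\mathbb Q/d\mathbb P}(x)\}$ for $0<p<1$. **Theorem (Classification of complete markets up to a casino).** 1. Let $M$ be a complete market on a standard probability space, with pricing measure $\mathbb Q$ and constant $C$. Let $\tilde M$ be the market on $[0,1]$ with Lebesgue measure and with pricing function $$\tilde c(X)=C\int_0^1 F^{-1}_{d\mathbb Q/d\mathbb P}(x)\,X(x)\,dx,$$ the integral being read as the extended expectation above. Then $\tilde M$ is complete, with constant $C$ and pricing measure $\tilde{\mathbb Q}(A)=\int_A F^{-1}_{d\mathbb Q/d\mathbb P}(x)\,dx$, and $M\times I$ is isomorphic to $\tilde M\times I$. 2. Consequently, up to a casino, a complete market is determined by its constant and the distribution of $\frac{d\mathbb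 Q}{d\mathbb P}$: if $M_1$ and $M_2$ are complete markets on standard probability spaces, with pricing measures $\mathbb Q_1,\mathbb Q_2$ and constants $C_1,C_2$, then $M_1\times I$ and $M_2\times I$ are isomorphic if and only if $C_1=C_2$ and the distribution of $\frac{d\mathbb Q_1}{d\mathbb P_1}$ under $\mathbb P_1$ equals that of $\frac{d\mathbb Q_2}{d\mathbb P_2}$ under $\mathbb P_2$. -/

import Mathlib

open MeasureTheory ProbabilityTheory Set
open scoped ENNReal NNReal unitInterval

universe u v

noncomputable section

namespace FinMarket

/-! ### Probability spaces, homomorphisms and standard spaces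

All probability spaces are regarded as complete, i.e. a measure space `(Ω, F, P)` stands for its
completion (products carry the completed product σ-algebra, `[0,1]` carries the Lebesgue sets).
Accordingly "measurable" is `NullMeasurable`, which is measurability for the completed σ-algebra;
when `F` is already complete this is ordinary measurability. -/

section Prob

variable {Ω₁ : Type u} {Ω₂ : Type v} [MeasurableSpace Ω₁] [MeasurableSpace Ω₂]

/-- A homomorphism of probability spaces: a measurable, measure-preserving map. -/
structure IsHom (φ : Ω₁ → Ω₂) (P₁ : Measure Ω₁) (P₂ : Measure Ω₂) : Prop where
  nullMeasurable : NullMeasurable φ P₁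
  measure_preimage : ∀ U : Set Ω₂, MeasurableSet U → P₁ (φ ⁻¹' U) = P₂ U

/-- `φ` is an isomorphism mod 0: there are subsets `A`, `B` of full measure such that `φ` restricts
to a bijection of `A` onto `B` which, together with its inverse, is measurable and
measure preserving. -/
def IsMod0Iso (φ : Ω₁ → Ω₂) (P₁ : Measure Ω₁) (P₂ : Measure Ω₂) : Prop :=
  ∃ (A : Set Ω₁) (B : Set Ω₂), P₁ Aᶜ = 0 ∧ P₂ Bᶜ = 0 ∧ BijOn φ A B ∧
    (∀ U : Set Ω₂, MeasurableSet U →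
      NullMeasurableSet (A ∩ φ ⁻¹' U) P₁ ∧ P₁ (A ∩ φ ⁻¹' U) = P₂ U) ∧
    (∀ V : Set Ω₁, MeasurableSet V →
      NullMeasurableSet (φ '' (A ∩ V)) P₂ ∧ P₂ (φ '' (A ∩ V)) = P₁ V)

/-- The convex combination `a · (Lebesgue measure on [0,1]) + b · p`, where `p` is a probability
measure on the countable discrete space `ℕ` (points of mass zero are allowed, so that finitely many
atoms are covered). The cases `b = 0` and `a = 0` are the two pure types. -/
def standardModel (a b : ℝ≥0) (p : PMF ℕ) : Measure (I ⊕ ℕ) :=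
  (a : ℝ≥0∞) • (volume : Measure I).map Sum.inl + (b : ℝ≥0∞) • p.toMeasure.map Sum.inr

/-- A probability measure is standard if it is isomorphic mod 0 to Lebesgue measure on `[0,1]`, to
a probability space on finitely or countably many atoms, or to a convex combination of both. -/
def IsStandard (P : Measure Ω₁) : Prop :=
  ∃ (a b : ℝ≥0) (p : PMF ℕ), a + b = 1 ∧ ∃ φ : Ω₁ → I ⊕ ℕ, IsMod0Iso φ P (standardModel a b p)

theorem IsHom.aestronglyMeasurable_comp {φ : Ω₁ → Ω₂} {P₁ : Measure Ω₁} {P₂ : Measure Ω₂}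
    (h : IsHom φ P₁ P₂) (X : Ω₂ →ₘ[P₂] ℝ) :
    AEStronglyMeasurable (fun ω => X (φ ω)) P₁ := by
  have hX : NullMeasurable (fun ω => X (φ ω)) P₁ := fun s hs =>
    h.nullMeasurable (X.measurable hs)
  exact hX.aemeasurable.aestronglyMeasurable

/-- The map `X ↦ X ∘ φ` from `L⁰(Ω₂)` to `L⁰(Ω₁)` induced by a homomorphism `φ`. -/
def IsHom.pullback {φ : Ω₁ → Ω₂} {P₁ : Measure Ω₁} {P₂ : Measure Ω₂}
    (h : IsHom φ P₁ P₂) (X : Ω₂ →ₘ[P₂] ℝ) : Ω₁ →ₘ[P₁] ℝ :=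
  AEEqFun.mk (fun ω => X (φ ω)) (h.aestronglyMeasurable_comp X)

end Prob

/-! ### One-period markets -/

/-- A one-period financial market: a probability space with a cost function
`c : L⁰(Ω; ℝ) → ℝ ∪ {±∞}`. -/
structure Market where
  Ω : Type u
  [mΩ : MeasurableSpace Ω]
  P : Measure Ω
  [isProb : IsProbabilityMeasure P]
  c : (Ω →ₘ[P] ℝ) → EReal

attribute [instance] Market.mΩ Market.isProb

/-- `φ` represents a morphism of markets `M₁ → M₂`: a homomorphism of probability spaces with
`c₂(X) ≥ c₁(X ∘ φ)` for all `X`. -/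
structure IsMorphism (M₁ : Market.{u}) (M₂ : Market.{v}) (φ : M₁.Ω → M₂.Ω) : Prop where
  isHom : IsHom φ M₁.P M₂.P
  cost_le : ∀ X : M₂.Ω →ₘ[M₂.P] ℝ, M₁.c (isHom.pullback X) ≤ M₂.c X

/-- Two markets are isomorphic: there are morphisms in both directions which are inverse to each
other almost surely. -/
def Isomorphic (M₁ : Market.{u}) (M₂ : Market.{v}) : Prop :=
  ∃ (φ : M₁.Ω → M₂.Ω) (ψ : M₂.Ω → M₁.Ω), IsMorphism M₁ M₂ φ ∧ IsMorphism M₂ M₁ ψ ∧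
    (∀ᵐ ω ∂M₁.P, ψ (φ ω) = ω) ∧ (∀ᵐ ω ∂M₂.P, φ (ψ ω) = ω)

/-! ### Complete markets -/

/-- The extended expectation `E(f⁺) - E(f⁻)` if at least one of the two terms is finite, and `∞`
otherwise. -/
def extExpectation {Ω : Type u} [MeasurableSpace Ω] (μ : Measure Ω) (f : Ω → ℝ) : EReal :=
  open Classical in
  if (∫⁻ ω, ENNReal.ofReal (f ω) ∂μ) < ∞ ∨ (∫⁻ ω, ENNReal.ofReal (-f ω) ∂μ) < ∞ then
    ((∫⁻ ω, ENNReal.ofReal (f ω) ∂μ : ℝ≥0∞) : EReal) -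
      ((∫⁻ ω, ENNReal.ofReal (-f ω) ∂μ : ℝ≥0∞) : EReal)
  else ⊤

/-- The market `M` is complete, with pricing measure `Q` and constant `C`: `Q` is a probability
measure equivalent to `P`, `C > 0`, and `c(X) = C (E_Q(X⁺) - E_Q(X⁻))` (read as `∞` if both terms
are infinite). -/
structure Market.IsCompleteWith (M : Market.{u}) (Q : Measure M.Ω) (C : ℝ) : Prop where
  isProb : IsProbabilityMeasure Q
  ac : Q ≪ M.P
  ac' : M.P ≪ Q
  pos : 0 < C
  cost : ∀ X : M.Ω →ₘ[M.P] ℝ, M.c X = (C : EReal) * extExpectation Q X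

/-- The market on the probability space `(Ω, P)` whose prices are given by the measure `Q` and the
constant `C`. -/
abbrev pricedMarket {Ω : Type u} [MeasurableSpace Ω] (P : Measure Ω) [IsProbabilityMeasure P]
    (Q : Measure Ω) (C : ℝ) : Market.{u} where
  Ω := Ω
  P := P
  c X := (C : EReal) * extExpectation Q X

/-- Lebesgue measure on `[0,1)`. -/
def lebesgueIco : Measure (Ico (0 : ℝ) 1) := (volume : Measure ℝ).comap Subtype.val

instance instIsProbabilityMeasureLebesgueIco : IsProbabilityMeasure lebesgueIco where
  measure_univ := by
    rw [lebesgueIco, comap_subtype_coe_apply measurableSet_Ico, image_univ, Subtype.range_coe,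
      Real.volume_Ico]
    simp

/-- The casino: `[0,1)` where `P` and `Q` are both Lebesgue measure, with constant `1`. -/
abbrev casino : Market.{0} := pricedMarket lebesgueIco lebesgueIco 1

/-- The product `M × I` of a complete market `M`, with pricing measure `Q` and constant `C`, and the
casino: products of the `P`-measures and of the `Q`-measures, and the constant `C` of `M`. -/
abbrev Market.timesCasino (M : Market.{u}) (Q : Measure M.Ω) (C : ℝ) : Market.{u} :=
  pricedMarket (M.P.prod casino.P) (Q.prod casino.P) C

/-- The distribution of the Radon-Nikodym derivative `dQ/dP` under `P`. -/
def densityLaw {Ω : Type u} [MeasurableSpace Ω] (P Q : Measure Ω) : Measure ℝ :=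
  P.map (fun ω => (Q.rnDeriv P ω).toReal)

/-- The inverse distribution function `F⁻¹(p) = inf {x | p ≤ F(x)}` of a probability measure on
`ℝ`, for `0 < p < 1` (the values at the two end points are irrelevant). -/
def invCDF (μ : Measure ℝ) (p : ℝ) : ℝ := sInf {x : ℝ | p ≤ cdf μ x}

/-- The market `M̃`: the space `[0,1]` with Lebesgue measure and the pricing function
`c̃(X) = C ∫₀¹ F⁻¹(x) X(x) dx`, where `F` is the distribution function of `μ`. As for all complete
markets, the integral is `∞` if its positive and negative parts are both infinite. -/
abbrev tildeMarket (μ : Measure ℝ) (C : ℝ) : Market.{0} where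
  Ω := I
  P := volume
  c X := (C : EReal) * extExpectation (volume : Measure I) (fun x => invCDF μ x * X x)

/-- The measure on `[0,1]` with density `F⁻¹` with respect to Lebesgue measure. -/
def tildeMeasure (μ : Measure ℝ) : Measure I :=
  (volume : Measure I).withDensity (fun x => ENNReal.ofReal (invCDF μ x))

end FinMarket

end

-- Multiplying by the casino makes the fibers of the density `g = dQ/dP` atomless. Given `g = t`,
-- the conditional law on the product is (conditional law on `M`) ⊗ Lebesgue, and its conditional
-- distribution function straightens it to the uniform law on `(0,1)`. Hence the product, labelled
-- by `g`, is isomorphic mod 0 to (law of `g`) ⊗ uniform, labelled by the first coordinate: a normal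
-- form depending only on the law of `g` (`labelledIso_compProd`, `labelledIso_prod_of_isStandard`).
-- The quantile function has that same law under Lebesgue measure (`map_invCDF`), so `M` and its
-- tilde market share a normal form. An isomorphism matching densities also matches pricing
-- measures, hence prices (`LabelledIso.isomorphic`).
--
-- Conversely, invertibility turns the cost inequalities into equalities. Indicators then recover
-- the constant and the pricing measure (`Isomorphic.exists_isIso`), so the densities correspond
-- (`IsIso.density_comp_ae_eq`) and have equal laws.

universe w

noncomputable section

namespace FinMarket

/-! ### Homomorphisms and isomorphisms mod 0 -/

section Hom

variable {Ω₁ : Type u} {Ω₂ : Type v} {Ω₃ : Type w}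
  [MeasurableSpace Ω₁] [MeasurableSpace Ω₂] [MeasurableSpace Ω₃]
  {P₁ : Measure Ω₁} {P₂ : Measure Ω₂} {P₃ : Measure Ω₃}

namespace IsHom

theorem preimage_null {φ : Ω₁ → Ω₂} (h : IsHom φ P₁ P₂) {N : Set Ω₂} (hN : P₂ N = 0) :
    P₁ (φ ⁻¹' N) = 0 := by
  obtain ⟨T, hNT, hT, hT0⟩ := exists_measurable_superset_of_null hN
  exact measure_mono_null (preimage_mono hNT) ((h.measure_preimage T hT).trans hT0)

theorem ae_comp {φ : Ω₁ → Ω₂} (h : IsHom φ P₁ P₂) {p : Ω₂ → Prop} (hp : ∀ᵐ y ∂P₂, p y) :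
    ∀ᵐ x ∂P₁, p (φ x) :=
  h.preimage_null hp

theorem preimage_ae_eq {φ : Ω₁ → Ω₂} (h : IsHom φ P₁ P₂) {s t : Set Ω₂} (hst : s =ᵐ[P₂] t) :
    φ ⁻¹' s =ᵐ[P₁] φ ⁻¹' t :=
  h.ae_comp hst

theorem nullMeasurableSet_preimage {φ : Ω₁ → Ω₂} (h : IsHom φ P₁ P₂) {s : Set Ω₂}
    (hs : NullMeasurableSet s P₂) : NullMeasurableSet (φ ⁻¹' s) P₁ := by
  obtain ⟨t, -, ht, hts⟩ := hs.exists_measurable_superset_ae_eq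
  exact NullMeasurableSet.congr (h.nullMeasurable ht) (h.preimage_ae_eq hts)

theorem measure_preimage₀ {φ : Ω₁ → Ω₂} (h : IsHom φ P₁ P₂) {s : Set Ω₂}
    (hs : NullMeasurableSet s P₂) : P₁ (φ ⁻¹' s) = P₂ s := by
  obtain ⟨t, -, ht, hts⟩ := hs.exists_measurable_superset_ae_eq
  rw [← measure_congr (h.preimage_ae_eq hts), h.measure_preimage t ht, measure_congr hts]

theorem comp {φ : Ω₁ → Ω₂} {χ : Ω₂ → Ω₃} (hχ : IsHom χ P₂ P₃) (hφ : IsHom φ P₁ P₂) :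
    IsHom (χ ∘ φ) P₁ P₃ where
  nullMeasurable _ hs := hφ.nullMeasurableSet_preimage (hχ.nullMeasurable hs)
  measure_preimage U hU := by
    rw [preimage_comp, hφ.measure_preimage₀ (hχ.nullMeasurable hU), hχ.measure_preimage U hU]

theorem aemeasurable_comp {β : Type*} [MeasurableSpace β] [MeasurableSpace.CountablyGenerated β]
    {φ : Ω₁ → Ω₂} (h : IsHom φ P₁ P₂) {g : Ω₂ → β} (hg : AEMeasurable g P₂) :
    AEMeasurable (fun x => g (φ x)) P₁ :=
  NullMeasurable.aemeasurable fun _ hs =>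
    h.nullMeasurableSet_preimage (hg.nullMeasurable hs)

theorem map_comp_eq {β : Type*} [MeasurableSpace β] [MeasurableSpace.CountablyGenerated β]
    {φ : Ω₁ → Ω₂} (h : IsHom φ P₁ P₂) {g : Ω₂ → β} (hg : AEMeasurable g P₂) :
    P₁.map (fun x => g (φ x)) = P₂.map g := by
  ext s hs
  rw [Measure.map_apply_of_aemeasurable (h.aemeasurable_comp hg) hs,
    Measure.map_apply_of_aemeasurable hg hs]
  exact h.measure_preimage₀ (hg.nullMeasurable hs)

theorem lintegral_comp {φ : Ω₁ → Ω₂} (h : IsHom φ P₁ P₂) {g : Ω₂ → ℝ≥0∞}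
    (hg : AEMeasurable g P₂) : ∫⁻ x, g (φ x) ∂P₁ = ∫⁻ y, g y ∂P₂ := by
  rw [← lintegral_map' (f := fun z : ℝ≥0∞ => z) aemeasurable_id (h.aemeasurable_comp hg),
    h.map_comp_eq hg,
    lintegral_map' (f := fun z : ℝ≥0∞ => z) aemeasurable_id hg]

/-- Since `φ` is only null measurable, the product map is treated as a measurable map out of the
completion. Its image measure agrees with the product measure on rectangles, which determines it. -/
theorem prodMap_id {Ω : Type*} [MeasurableSpace Ω] {L : Measure Ω} [SigmaFinite L]
    [SigmaFinite P₁] [SigmaFinite P₂] {φ : Ω₁ → Ω₂} (h : IsHom φ P₁ P₂) :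
    IsHom (Prod.map φ (id : Ω → Ω)) (P₁.prod L) (P₂.prod L) := by
  have hm : Measurable (fun x : NullMeasurableSpace (Ω₁ × Ω) (P₁.prod L) =>
      (Prod.map φ (id : Ω → Ω) x : Ω₂ × Ω)) := by
    refine Measurable.prodMk (fun s hs => ?_) (fun t ht => ?_)
    · have := (show NullMeasurableSet (φ ⁻¹' s) P₁ from h.nullMeasurable hs).prod
        (MeasurableSet.univ.nullMeasurableSet (μ := L))
      rw [prod_univ] at this
      exact this
    · exact (measurable_snd ht).nullMeasurableSet
  have hmap : P₂.prod L = Measure.map (fun x : NullMeasurableSpace (Ω₁ × Ω) (P₁.prod L) =>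
      (Prod.map φ (id : Ω → Ω) x : Ω₂ × Ω)) (P₁.prod L).completion := by
    refine Measure.prod_eq fun s t hs ht => ?_
    rw [Measure.map_apply hm (hs.prod ht)]
    refine (Measure.completion_apply (P₁.prod L) ((φ ⁻¹' s) ×ˢ t)).trans ?_
    rw [Measure.prod_prod, h.measure_preimage s hs]
  refine ⟨fun s hs => hm hs, fun U hU => ?_⟩
  rw [hmap, Measure.map_apply hm hU]
  exact (Measure.completion_apply (P₁.prod L) (Prod.map φ id ⁻¹' U)).symm

end IsHom

theorem _root_.MeasureTheory.MeasurePreserving.isHom {φ : Ω₁ → Ω₂}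
    (h : MeasurePreserving φ P₁ P₂) : IsHom φ P₁ P₂ where
  nullMeasurable := h.measurable.nullMeasurable
  measure_preimage _ hU := h.measure_preimage hU.nullMeasurableSet

/-- `φ` and `ψ` are homomorphisms of probability spaces which are inverse to each other almost
surely. -/
structure IsIso (φ : Ω₁ → Ω₂) (ψ : Ω₂ → Ω₁) (P₁ : Measure Ω₁) (P₂ : Measure Ω₂) : Prop where
  hom : IsHom φ P₁ P₂
  inv : IsHom ψ P₂ P₁
  left_inv : ∀ᵐ x ∂P₁, ψ (φ x) = x
  right_inv : ∀ᵐ y ∂P₂, φ (ψ y) = y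

theorem IsIso.symm {φ : Ω₁ → Ω₂} {ψ : Ω₂ → Ω₁} (h : IsIso φ ψ P₁ P₂) : IsIso ψ φ P₂ P₁ :=
  ⟨h.inv, h.hom, h.right_inv, h.left_inv⟩

theorem IsIso.trans {φ : Ω₁ → Ω₂} {ψ : Ω₂ → Ω₁} {φ' : Ω₂ → Ω₃} {ψ' : Ω₃ → Ω₂}
    (h : IsIso φ ψ P₁ P₂) (h' : IsIso φ' ψ' P₂ P₃) : IsIso (φ' ∘ φ) (ψ ∘ ψ') P₁ P₃ where
  hom := h'.hom.comp h.hom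
  inv := h.inv.comp h'.inv
  left_inv := by
    filter_upwards [h.left_inv, h.hom.ae_comp h'.left_inv] with x hx hx'
    simp only [Function.comp_apply, hx', hx]
  right_inv := by
    filter_upwards [h'.right_inv, h'.inv.ae_comp h.right_inv] with x hx hx'
    simp only [Function.comp_apply, hx', hx]

theorem IsIso.prodMap_id {Ω : Type*} [MeasurableSpace Ω] {L : Measure Ω} [SigmaFinite L]
    [SigmaFinite P₁] [SigmaFinite P₂] {φ : Ω₁ → Ω₂} {ψ : Ω₂ → Ω₁} (h : IsIso φ ψ P₁ P₂) :
    IsIso (Prod.map φ (id : Ω → Ω)) (Prod.map ψ id) (P₁.prod L) (P₂.prod L) where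
  hom := h.hom.prodMap_id
  inv := h.inv.prodMap_id
  left_inv := by
    filter_upwards [Measure.quasiMeasurePreserving_fst.ae h.left_inv] with x hx
    exact Prod.ext hx rfl
  right_inv := by
    filter_upwards [Measure.quasiMeasurePreserving_fst.ae h.right_inv] with x hx
    exact Prod.ext hx rfl

/-- If `ψ` is measure preserving and `φ` is a measurable almost sure left inverse of `ψ`, then `φ`
and `ψ` form an isomorphism mod 0. -/
theorem IsIso.of_inverse {φ : Ω₁ → Ω₂} {ψ : Ω₂ → Ω₁} (hφ : Measurable φ)
    (hψ : MeasurePreserving ψ P₂ P₁) (hinv : ∀ᵐ y ∂P₂, φ (ψ y) = y)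
    (hleft : MeasurableSet {x | ψ (φ x) = x}) : IsIso φ ψ P₁ P₂ where
  hom := by
    -- As `P₁` is the image of `P₂` under `ψ`, its image under `φ` is that of `P₂` under `φ ∘ ψ`,
    -- which is almost surely the identity.
    refine MeasurePreserving.isHom ⟨hφ, ?_⟩
    rw [← hψ.map_eq, Measure.map_map hφ hψ.measurable,
      Measure.map_congr (show φ ∘ ψ =ᵐ[P₂] id from hinv), Measure.map_id]
  inv := hψ.isHom
  left_inv := by
    rw [← hψ.map_eq, ae_map_iff hψ.measurable.aemeasurable hleft]
    filter_upwards [hinv] with y hy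
    rw [hy]
  right_inv := hinv

/-- An isomorphism mod 0 in the sense of full-measure subsets yields homomorphisms in both
directions. -/
theorem IsMod0Iso.exists_isIso [Nonempty Ω₁] {φ : Ω₁ → Ω₂} (h : IsMod0Iso φ P₁ P₂) :
    ∃ ψ : Ω₂ → Ω₁, IsIso φ ψ P₁ P₂ := by
  obtain ⟨A, B, hA, hB, hbij, h1, h2⟩ := h
  have hl : LeftInvOn (Function.invFunOn φ A) φ A := hbij.injOn.leftInvOn_invFunOn
  have hr : RightInvOn (Function.invFunOn φ A) φ B := hbij.surjOn.rightInvOn_invFunOn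
  have hmaps : MapsTo (Function.invFunOn φ A) B A := hbij.surjOn.mapsTo_invFunOn
  have hAae : ∀ᵐ x ∂P₁, x ∈ A := hA
  have hBae : ∀ᵐ x ∂P₂, x ∈ B := hB
  have e1 : ∀ U : Set Ω₂, (A ∩ φ ⁻¹' U : Set Ω₁) =ᵐ[P₁] φ ⁻¹' U := fun U => by
    filter_upwards [hAae] with x hx
    exact propext ⟨fun h => h.2, fun h => ⟨hx, h⟩⟩
  have e2 : ∀ V : Set Ω₁, (φ '' (A ∩ V) : Set Ω₂) =ᵐ[P₂] Function.invFunOn φ A ⁻¹' V :=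
    fun V => by
    filter_upwards [hBae] with y hy
    refine propext ⟨?_, fun h => ⟨_, ⟨hmaps hy, h⟩, hr hy⟩⟩
    rintro ⟨x, ⟨hx, hxV⟩, rfl⟩
    change Function.invFunOn φ A (φ x) ∈ V
    rwa [hl hx]
  refine ⟨Function.invFunOn φ A, ⟨fun U hU => ?_, fun U hU => ?_⟩,
    ⟨fun V hV => ?_, fun V hV => ?_⟩, ?_, ?_⟩
  · exact NullMeasurableSet.congr (h1 U hU).1 (e1 U)
  · rw [← measure_congr (e1 U), (h1 U hU).2]
  · exact NullMeasurableSet.congr (h2 V hV).1 (e2 V)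
  · rw [← measure_congr (e2 V), (h2 V hV).2]
  · filter_upwards [hAae] with x hx using hl hx
  · filter_upwards [hBae] with y hy using hr hy

/-- The probability spaces with real functions `(P₁, f₁)` and `(P₂, f₂)` are isomorphic mod 0. -/
def LabelledIso (P₁ : Measure Ω₁) (f₁ : Ω₁ → ℝ) (P₂ : Measure Ω₂) (f₂ : Ω₂ → ℝ) : Prop :=
  ∃ (φ : Ω₁ → Ω₂) (ψ : Ω₂ → Ω₁), IsIso φ ψ P₁ P₂ ∧ ∀ᵐ x ∂P₁, f₂ (φ x) = f₁ x

theorem LabelledIso.symm {f₁ : Ω₁ → ℝ} {f₂ : Ω₂ → ℝ} (h : LabelledIso P₁ f₁ P₂ f₂) :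
    LabelledIso P₂ f₂ P₁ f₁ := by
  obtain ⟨φ, ψ, hi, hf⟩ := h
  refine ⟨ψ, φ, hi.symm, ?_⟩
  filter_upwards [hi.inv.ae_comp hf, hi.right_inv] with y hy hy'
  rw [← hy, hy']

theorem LabelledIso.trans {f₁ : Ω₁ → ℝ} {f₂ : Ω₂ → ℝ} {f₃ : Ω₃ → ℝ}
    (h : LabelledIso P₁ f₁ P₂ f₂) (h' : LabelledIso P₂ f₂ P₃ f₃) : LabelledIso P₁ f₁ P₃ f₃ := by
  obtain ⟨φ, ψ, hi, hf⟩ := h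
  obtain ⟨φ', ψ', hi', hf'⟩ := h'
  refine ⟨_, _, hi.trans hi', ?_⟩
  filter_upwards [hf, hi.hom.ae_comp hf'] with x hx hx'
  rw [← hx, ← hx', Function.comp_apply]

end Hom

/-! ### Quantile functions -/

section Quantile

variable (μ : Measure ℝ)

/-- Right continuity of the distribution function makes the infimum attained; `0 < p < 1` makes the
set nonempty and bounded below. -/
theorem invCDF_le_iff {p : ℝ} (hp : p ∈ Ioo (0 : ℝ) 1) (x : ℝ) :
    invCDF μ p ≤ x ↔ p ≤ cdf μ x := by
  have hne : {x : ℝ | p ≤ cdf μ x}.Nonempty := by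
    obtain ⟨y, hy⟩ := ((tendsto_cdf_atTop μ).eventually (lt_mem_nhds hp.2)).exists
    exact ⟨y, hy.le⟩
  have hbdd : BddBelow {x : ℝ | p ≤ cdf μ x} := by
    obtain ⟨y, hy⟩ := ((tendsto_cdf_atBot μ).eventually (gt_mem_nhds hp.1)).exists
    refine ⟨y, fun z hz => ?_⟩
    by_contra! hlt
    exact absurd (hz.trans (monotone_cdf μ hlt.le)) (not_le.2 hy)
  refine ⟨fun h => ?_, fun h => csInf_le hbdd h⟩
  refine ge_of_tendsto (((cdf μ).right_continuous x).tendsto.mono_left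
    (nhdsWithin_mono x Ioi_subset_Ici_self)) ?_
  filter_upwards [self_mem_nhdsWithin] with y hy
  obtain ⟨z, hz, hzy⟩ := exists_lt_of_csInf_lt hne (h.trans_lt hy)
  exact le_trans hz (monotone_cdf μ hzy.le)

theorem monotoneOn_invCDF : MonotoneOn (invCDF μ) (Ioo 0 1) := fun p hp q hq hpq => by
  rw [invCDF_le_iff μ hp]
  exact hpq.trans ((invCDF_le_iff μ hq _).1 le_rfl)

theorem aemeasurable_invCDF : AEMeasurable (invCDF μ) (volume.restrict (Ioo (0 : ℝ) 1)) :=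
  aemeasurable_restrict_of_monotoneOn measurableSet_Ioo (monotoneOn_invCDF μ)

instance isProbabilityMeasure_volume_restrict_Ioo :
    IsProbabilityMeasure ((volume : Measure ℝ).restrict (Ioo 0 1)) :=
  ⟨by simp⟩

variable [IsProbabilityMeasure μ]

theorem map_invCDF : (volume.restrict (Ioo (0 : ℝ) 1)).map (invCDF μ) = μ := by
  have : IsProbabilityMeasure ((volume.restrict (Ioo (0 : ℝ) 1)).map (invCDF μ)) :=
    Measure.isProbabilityMeasure_map (aemeasurable_invCDF μ)
  refine Measure.ext_of_Iic _ _ fun x => ?_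
  rw [Measure.map_apply_of_aemeasurable (aemeasurable_invCDF μ) measurableSet_Iic,
    Measure.restrict_apply' measurableSet_Ioo]
  have h : invCDF μ ⁻¹' Iic x ∩ Ioo 0 1 = Iic (cdf μ x) ∩ Ioo 0 1 := by
    ext p
    simp only [mem_inter_iff, mem_preimage, mem_Iic, and_congr_left_iff]
    exact fun hp => invCDF_le_iff μ hp x
  rw [h, ← Measure.restrict_apply' measurableSet_Ioo, Measure.restrict_congr_set Ioo_ae_eq_Ioc,
    Measure.restrict_apply' measurableSet_Ioc, ← ofReal_cdf]
  have h' : Iic (cdf μ x) ∩ Ioc 0 1 = Ioc 0 (cdf μ x) := by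
    ext p
    simp only [mem_inter_iff, mem_Iic, mem_Ioc]
    exact ⟨fun h => ⟨h.2.1, h.1⟩, fun h => ⟨h.2, h.1, h.2.trans (cdf_le_one μ x)⟩⟩
  rw [h', Real.volume_Ioc, sub_zero]

/-- Left of the quantile the distribution function stays below `p`, and without atoms it cannot jump
over `p`. -/
theorem cdf_invCDF [NullSingletonClass μ] {p : ℝ} (hp : p ∈ Ioo (0 : ℝ) 1) : cdf μ (invCDF μ p) = p := by
  refine le_antisymm ?_ ((invCDF_le_iff μ hp _).1 le_rfl)
  have h0 : cdf μ (invCDF μ p) ≤ Function.leftLim (cdf μ) (invCDF μ p) := by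
    have h := (cdf μ).measure_singleton (invCDF μ p)
    rw [measure_cdf, measure_singleton] at h
    linarith [ENNReal.ofReal_eq_zero.1 h.symm]
  refine h0.trans (le_of_tendsto ((monotone_cdf μ).tendsto_leftLim _) ?_)
  filter_upwards [self_mem_nhdsWithin] with y hy
  by_contra! hlt
  exact absurd ((invCDF_le_iff μ hp y).2 hlt.le) (not_le.2 hy)

end Quantile

/-! ### Borel structure of a disjoint sum -/

section Sum

/-- Serves to make the model space `I ⊕ ℕ` standard Borel, so that it admits conditional
distributions. -/
instance borelSpace_sum {α : Type u} {β : Type v} [TopologicalSpace α] [TopologicalSpace β]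
    [MeasurableSpace α] [MeasurableSpace β] [BorelSpace α] [BorelSpace β] :
    BorelSpace (α ⊕ β) where
  measurable_eq := by
    refine le_antisymm (fun s hs => ?_) (MeasurableSpace.generateFrom_le fun s hs => ?_)
    · have h1 : MeasurableSet (Sum.inl ⁻¹' s : Set α) := measurable_inl hs
      have h2 : MeasurableSet (Sum.inr ⁻¹' s : Set β) := measurable_inr hs
      let _ : MeasurableSpace (α ⊕ β) := borel _
      have : BorelSpace (α ⊕ β) := ⟨rfl⟩
      have h := (Topology.IsOpenEmbedding.inl (X := α)
        (Y := β)).measurableEmbedding.measurableSet_image' h1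
      have h' := (Topology.IsOpenEmbedding.inr (X := α)
        (Y := β)).measurableEmbedding.measurableSet_image' h2
      rw [← image_preimage_inl_union_image_preimage_inr s]
      exact h.union h'
    · have hs' := isOpen_sum_iff.1 hs
      exact measurableSet_sum_iff.2 ⟨hs'.1.measurableSet, hs'.2.measurableSet⟩

end Sum

/-! ### Straightening the fibers of a random variable -/

section Fiber

variable {Z : Type v} {J : Type w} [MeasurableSpace Z] [MeasurableSpace J]

/-- A disintegrated measure on `ℝ × ℝ` with atomless fibers is isomorphic, over the first factor,
to the product of its first marginal with the uniform distribution. -/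
theorem labelledIso_compProd (ν : Measure ℝ) [IsProbabilityMeasure ν] (κ : Kernel ℝ ℝ)
    [IsMarkovKernel κ] [∀ t, NullSingletonClass (κ t)] :
    LabelledIso (ν ⊗ₘ κ) Prod.fst (ν.prod (volume.restrict (Ioo (0 : ℝ) 1))) Prod.fst := by
  classical
  set φ : ℝ × ℝ → ℝ × ℝ := fun q => (q.1, cdf (κ q.1) q.2) with hφdef
  -- The fiberwise quantile map. The value `0` is taken on a null set only; it makes joint
  -- measurability checkable through `invCDF_le_iff`, which needs `p` in `(0,1)`.
  set ψ : ℝ × ℝ → ℝ × ℝ :=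
    fun q => (q.1, if q.2 ∈ Ioo (0 : ℝ) 1 then invCDF (κ q.1) q.2 else 0) with hψdef
  have hcdf : ∀ x : ℝ, Measurable fun t => cdf (κ t) x := fun x => by
    simp only [cdf_eq_real, Measure.real]
    exact (κ.measurable_coe measurableSet_Iic).ennreal_toReal
  have hφ : Measurable φ := by
    refine measurable_fst.prodMk ?_
    simp only [cdf_eq_real, Measure.real]
    refine Measurable.ennreal_toReal ?_
    have hs : MeasurableSet {z : (ℝ × ℝ) × ℝ | z.2 ≤ z.1.2} :=
      measurableSet_le measurable_snd measurable_fst.snd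
    exact Kernel.measurable_kernel_prodMk_left (κ := κ.comap Prod.fst measurable_fst) hs
  have hψ : Measurable ψ := by
    refine measurable_fst.prodMk (measurable_of_Iic fun x => ?_)
    have h : (fun q : ℝ × ℝ => if q.2 ∈ Ioo (0 : ℝ) 1 then invCDF (κ q.1) q.2 else 0) ⁻¹' Iic x =
        (Prod.snd ⁻¹' Ioo (0 : ℝ) 1 ∩ {q | q.2 ≤ cdf (κ q.1) x}) ∪
          ((Prod.snd ⁻¹' Ioo (0 : ℝ) 1)ᶜ ∩ {_q | 0 ≤ x}) := by
      ext ⟨t, p⟩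
      by_cases hp : p ∈ Ioo (0 : ℝ) 1
      · simp [hp, -mem_Ioo, invCDF_le_iff (κ t) hp]
      · simp [hp, -mem_Ioo]
    rw [h]
    have hI : MeasurableSet (Prod.snd ⁻¹' Ioo (0 : ℝ) 1 : Set (ℝ × ℝ)) :=
      measurable_snd measurableSet_Ioo
    exact (hI.inter (measurableSet_le measurable_snd ((hcdf x).comp measurable_fst))).union
      (hI.compl.inter (MeasurableSet.const _))
  have hmp : MeasurePreserving ψ (ν.prod (volume.restrict (Ioo (0 : ℝ) 1))) (ν ⊗ₘ κ) := by
    refine ⟨hψ, Measure.ext fun s hs => ?_⟩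
    rw [Measure.map_apply hψ hs, Measure.prod_apply (hψ hs), Measure.compProd_apply hs]
    refine lintegral_congr fun t => ?_
    have hst : MeasurableSet (Prod.mk t ⁻¹' s) := measurable_prodMk_left hs
    conv_rhs => rw [← map_invCDF (κ t),
      Measure.map_apply_of_aemeasurable (aemeasurable_invCDF (κ t)) hst]
    refine measure_congr ?_
    filter_upwards [ae_restrict_mem measurableSet_Ioo] with p hp
    refine propext ?_
    change (t, if p ∈ Ioo (0 : ℝ) 1 then invCDF (κ t) p else 0) ∈ s ↔ (t, invCDF (κ t) p) ∈ s
    rw [if_pos hp]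
  -- The only use of atomlessness: with atoms, quantiles do not determine levels.
  have hinv : ∀ᵐ q ∂ν.prod (volume.restrict (Ioo (0 : ℝ) 1)), φ (ψ q) = q := by
    filter_upwards [Measure.quasiMeasurePreserving_snd.ae
      (ae_restrict_mem (μ := (volume : Measure ℝ)) (measurableSet_Ioo (a := 0) (b := 1)))]
      with q hq
    simp only [hφdef, hψdef, if_pos hq, cdf_invCDF _ hq]
  exact ⟨φ, ψ, IsIso.of_inverse hφ hmp hinv (measurableSet_eq_fun (hψ.comp hφ) measurable_id),
    Filter.Eventually.of_forall fun _ => rfl⟩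

variable [StandardBorelSpace J] (L : Measure J) [IsProbabilityMeasure L] [NullSingletonClass L]

/-- Multiplied with an atomless space, a standard Borel probability space with a random variable `g`
becomes the product of the law of `g` with the uniform distribution. -/
theorem labelledIso_prod_of_standardBorel [StandardBorelSpace Z] (P : Measure Z)
    [IsProbabilityMeasure P] {g : Z → ℝ} (hg : Measurable g) :
    LabelledIso (P.prod L) (fun q => g q.1)
      ((P.map g).prod (volume.restrict (Ioo (0 : ℝ) 1))) Prod.fst := by
  have : Nonempty Z := nonempty_of_isProbabilityMeasure P
  have : Nonempty J := nonempty_of_isProbabilityMeasure L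
  have : IsProbabilityMeasure (P.map g) := Measure.isProbabilityMeasure_map hg.aemeasurable
  have he : MeasurableEmbedding (embeddingReal (Z × J)) := measurableEmbedding_embeddingReal _
  set e := embeddingReal (Z × J)
  set κ₀ : Kernel ℝ Z := condDistrib id g P
  -- Conditional law, given `g = t`, of the point of `Z × J` encoded as a real number. It has no
  -- atoms because `L` has none and `e` is injective.
  set κ : Kernel ℝ ℝ := (κ₀ ×ₖ Kernel.const ℝ L).map e with hκ
  have hκt : ∀ t, κ t = ((κ₀ t).prod L).map e := fun t => by
    rw [hκ, Kernel.map_apply _ he.measurable, Kernel.prod_apply, Kernel.const_apply]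
  have : IsMarkovKernel κ := Kernel.IsMarkovKernel.map _ he.measurable
  have : ∀ t, NullSingletonClass (κ t) := fun t => ⟨fun x => by
    rw [hκt, Measure.map_apply he.measurable (measurableSet_singleton x)]
    exact (subsingleton_singleton.preimage he.injective).measure_zero _⟩
  -- The second coordinate alone recovers the point; the first exposes the label, so that the image
  -- measure disintegrates over the law of `g`.
  set ψ : Z × J → ℝ × ℝ := fun q => (g q.1, e q)
  have hψ : Measurable ψ := (hg.comp measurable_fst).prodMk he.measurable
  have hmp : MeasurePreserving ψ (P.prod L) (P.map g ⊗ₘ κ) := by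
    refine ⟨hψ, Measure.ext fun s hs => ?_⟩
    have hT : Measurable fun q : ℝ × Z => L {u | (q.1, e (q.2, u)) ∈ s} := by
      have hm : Measurable fun r : (ℝ × Z) × J => (r.1.1, e (r.1.2, r.2)) :=
        measurable_fst.fst.prodMk (he.measurable.comp (measurable_fst.snd.prodMk measurable_snd))
      exact measurable_measure_prodMk_left (hm hs)
    have hd : P.map g ⊗ₘ κ₀ = P.map fun z => (g z, z) :=
      compProd_map_condDistrib aemeasurable_id
    calc (P.prod L).map ψ s = ∫⁻ z, L {u | (g z, e (z, u)) ∈ s} ∂P := by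
          rw [Measure.map_apply hψ hs, Measure.prod_apply (hψ hs)]
          rfl
      _ = ∫⁻ q, L {u | (q.1, e (q.2, u)) ∈ s} ∂(P.map g ⊗ₘ κ₀) := by
          rw [hd, lintegral_map hT (hg.prodMk measurable_id')]
      _ = ∫⁻ t, ∫⁻ z, L {u | (t, e (z, u)) ∈ s} ∂κ₀ t ∂(P.map g) :=
          Measure.lintegral_compProd hT
      _ = (P.map g ⊗ₘ κ) s := by
          rw [Measure.compProd_apply hs]
          refine lintegral_congr fun t => ?_
          have hst : MeasurableSet (Prod.mk t ⁻¹' s) := measurable_prodMk_left hs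
          rw [hκt, Measure.map_apply he.measurable hst, Measure.prod_apply (he.measurable hst)]
          rfl
  have hφ : Measurable fun q : ℝ × ℝ => he.invFun q.2 := he.measurable_invFun.comp measurable_snd
  have hinv : ∀ q, he.invFun (ψ q).2 = q := fun q => he.leftInverse_invFun q
  have h : LabelledIso (P.map g ⊗ₘ κ) Prod.fst (P.prod L) (fun q => g q.1) := by
    refine LabelledIso.symm ⟨ψ, _, (IsIso.of_inverse hφ hmp (Filter.Eventually.of_forall hinv)
      (measurableSet_eq_fun (hψ.comp hφ) measurable_id)).symm,
      Filter.Eventually.of_forall fun _ => rfl⟩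
  exact h.symm.trans (labelledIso_compProd _ κ)

theorem isProbabilityMeasure_standardModel {a b : ℝ≥0} (p : PMF ℕ) (h : a + b = 1) :
    IsProbabilityMeasure (standardModel a b p) where
  measure_univ := by
    have h' : (a : ℝ≥0∞) + b = 1 := by exact_mod_cast h
    simp [standardModel, Measure.map_apply measurable_inl, Measure.map_apply measurable_inr, h']

/-- Transport to the standard model, where `f ∘ ψ` is only a.e. measurable and gives way to a
measurable version. -/
theorem labelledIso_prod_of_isStandard {Ω : Type u} [MeasurableSpace Ω] {P : Measure Ω}
    [IsProbabilityMeasure P] (hP : IsStandard P) {f : Ω → ℝ} (hf : Measurable f) :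
    LabelledIso (P.prod L) (fun q => f q.1)
      ((P.map f).prod (volume.restrict (Ioo (0 : ℝ) 1))) Prod.fst := by
  have : Nonempty Ω := nonempty_of_isProbabilityMeasure P
  obtain ⟨a, b, p, hab, φ, hφ⟩ := hP
  have := isProbabilityMeasure_standardModel p hab
  obtain ⟨ψ, hi⟩ := hφ.exists_isIso
  have hfψ : AEMeasurable (fun z => f (ψ z)) (standardModel a b p) :=
    hi.inv.aemeasurable_comp hf.aemeasurable
  have hlaw : P.map f = (standardModel a b p).map (hfψ.mk _) := by
    rw [← hi.inv.map_comp_eq hf.aemeasurable]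
    exact Measure.map_congr hfψ.ae_eq_mk
  rw [hlaw]
  refine LabelledIso.trans ⟨_, _, hi.prodMap_id, ?_⟩
    (labelledIso_prod_of_standardBorel L (standardModel a b p) hfψ.measurable_mk)
  have hae : ∀ᵐ x ∂P, hfψ.mk _ (φ x) = f x := by
    filter_upwards [hi.left_inv, hi.hom.ae_comp hfψ.ae_eq_mk] with x hx hx'
    rw [← hx', hx]
  exact Measure.quasiMeasurePreserving_fst.ae hae

end Fiber

/-! ### Densities, prices and isomorphisms -/

section Pricing

variable {Ω₁ : Type u} {Ω₂ : Type v} [MeasurableSpace Ω₁] [MeasurableSpace Ω₂]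
  {P₁ : Measure Ω₁} {P₂ : Measure Ω₂} {Q₁ : Measure Ω₁} {Q₂ : Measure Ω₂}

theorem IsHom.withDensity [SFinite P₁] [SFinite P₂] {φ : Ω₁ → Ω₂} (h : IsHom φ P₁ P₂)
    {d₁ : Ω₁ → ℝ≥0∞} {d₂ : Ω₂ → ℝ≥0∞} (hd₂ : AEMeasurable d₂ P₂)
    (hd : ∀ᵐ x ∂P₁, d₂ (φ x) = d₁ x) :
    IsHom φ (P₁.withDensity d₁) (P₂.withDensity d₂) where
  nullMeasurable _ hs := (h.nullMeasurable hs).mono_ac (withDensity_absolutelyContinuous _ _)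
  measure_preimage U hU := by
    have hpre : NullMeasurableSet (φ ⁻¹' U) P₁ := h.nullMeasurable hU
    -- The preimage of `U` is only null measurable, hence the variants of the rules on its side.
    rw [withDensity_apply d₂ hU, withDensity_apply' _, ← lintegral_indicator hU,
      ← lintegral_indicator₀ hpre, ← h.lintegral_comp (hd₂.indicator hU)]
    refine lintegral_congr_ae ?_
    filter_upwards [hd] with x hx
    by_cases hxU : φ x ∈ U
    · rw [indicator_of_mem hxU, indicator_of_mem (show x ∈ φ ⁻¹' U from hxU), hx]
    · rw [indicator_of_notMem hxU, indicator_of_notMem (show x ∉ φ ⁻¹' U from hxU)]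

theorem extExpectation_eq_of_lintegral_eq {f : Ω₁ → ℝ} {g : Ω₂ → ℝ}
    (hpos : ∫⁻ x, ENNReal.ofReal (f x) ∂Q₁ = ∫⁻ y, ENNReal.ofReal (g y) ∂Q₂)
    (hneg : ∫⁻ x, ENNReal.ofReal (-f x) ∂Q₁ = ∫⁻ y, ENNReal.ofReal (-g y) ∂Q₂) :
    extExpectation Q₁ f = extExpectation Q₂ g := by
  simp only [extExpectation, hpos, hneg]

theorem extExpectation_congr_ae {f g : Ω₁ → ℝ} (h : f =ᵐ[Q₁] g) :
    extExpectation Q₁ f = extExpectation Q₁ g :=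
  extExpectation_eq_of_lintegral_eq
    (lintegral_congr_ae (h.mono fun _ hx => by simp only [hx]))
    (lintegral_congr_ae (h.mono fun _ hx => by simp only [hx]))

theorem IsHom.extExpectation_comp {φ : Ω₁ → Ω₂} (h : IsHom φ Q₁ Q₂) {f : Ω₂ → ℝ}
    (hf : Measurable f) : extExpectation Q₁ (fun x => f (φ x)) = extExpectation Q₂ f :=
  extExpectation_eq_of_lintegral_eq
    (h.lintegral_comp (g := fun y => ENNReal.ofReal (f y)) hf.ennreal_ofReal.aemeasurable)
    (h.lintegral_comp (g := fun y => ENNReal.ofReal (-f y)) hf.neg.ennreal_ofReal.aemeasurable)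

theorem extExpectation_indicator {U : Set Ω₁} (hU : NullMeasurableSet U Q₁) :
    extExpectation Q₁ (U.indicator 1) = (Q₁ U : EReal) := by
  have h1 : (fun x => ENNReal.ofReal (U.indicator (1 : Ω₁ → ℝ) x)) = U.indicator 1 := by
    ext x
    by_cases hx : x ∈ U <;> simp [hx]
  have h2 : (fun x => ENNReal.ofReal (-U.indicator (1 : Ω₁ → ℝ) x)) = 0 := by
    ext x
    by_cases hx : x ∈ U <;> simp [hx]
  have h3 : lintegral Q₁ 0 = 0 := lintegral_zero
  simp [extExpectation, h1, h2, h3, lintegral_indicator_one₀ hU]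

/-- The costs are in fact equal. `Q₁ ≪ P₁` enters because pullbacks are defined up to `P₁`-null
sets. -/
theorem isMorphism_pricedMarket [IsProbabilityMeasure P₁] [IsProbabilityMeasure P₂]
    (hQ₁ : Q₁ ≪ P₁) {φ : Ω₁ → Ω₂} (h : IsHom φ P₁ P₂) (hQ : IsHom φ Q₁ Q₂) (C : ℝ) :
    IsMorphism (pricedMarket P₁ Q₁ C) (pricedMarket P₂ Q₂ C) φ where
  isHom := h
  cost_le X := by
    have hX : extExpectation Q₁ (h.pullback X) = extExpectation Q₂ X := by
      rw [← hQ.extExpectation_comp X.measurable]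
      exact extExpectation_congr_ae (hQ₁.ae_le (AEEqFun.coeFn_mk _ _))
    exact (congrArg (fun z => (C : EReal) * z) hX).le

theorem LabelledIso.isomorphic [IsProbabilityMeasure P₁] [IsProbabilityMeasure P₂]
    {f₁ : Ω₁ → ℝ} {f₂ : Ω₂ → ℝ} (h : LabelledIso P₁ f₁ P₂ f₂)
    (hf₁ : AEMeasurable f₁ P₁) (hf₂ : AEMeasurable f₂ P₂)
    (hQ₁ : Q₁ = P₁.withDensity fun x => ENNReal.ofReal (f₁ x))
    (hQ₂ : Q₂ = P₂.withDensity fun x => ENNReal.ofReal (f₂ x)) (C : ℝ) :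
    Isomorphic (pricedMarket P₁ Q₁ C) (pricedMarket P₂ Q₂ C) := by
  subst hQ₁ hQ₂
  obtain ⟨φ, ψ, hi, hf⟩ := h
  have hf' : ∀ᵐ y ∂P₂, f₁ (ψ y) = f₂ y := by
    filter_upwards [hi.inv.ae_comp hf, hi.right_inv] with y hy hy'
    rw [← hy, hy']
  refine ⟨φ, ψ, isMorphism_pricedMarket (withDensity_absolutelyContinuous _ _) hi.hom
    (hi.hom.withDensity hf₂.ennreal_ofReal (hf.mono fun _ hx => by rw [hx])) C,
    isMorphism_pricedMarket (withDensity_absolutelyContinuous _ _) hi.inv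
    (hi.inv.withDensity hf₁.ennreal_ofReal (hf'.mono fun _ hx => by rw [hx])) C,
    hi.left_inv, hi.right_inv⟩

/-- An isomorphism of complete markets preserves the pricing measures and the constants. -/
theorem Isomorphic.exists_isIso [IsProbabilityMeasure P₁] [IsProbabilityMeasure P₂]
    [IsProbabilityMeasure Q₁] [IsProbabilityMeasure Q₂] (hQ₁ : Q₁ ≪ P₁) (hQ₂ : Q₂ ≪ P₂)
    {C₁ C₂ : ℝ} (hC₁ : 0 < C₁)
    (h : Isomorphic (pricedMarket P₁ Q₁ C₁) (pricedMarket P₂ Q₂ C₂)) :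
    C₁ = C₂ ∧ ∃ (φ : Ω₁ → Ω₂) (ψ : Ω₂ → Ω₁), IsIso φ ψ P₁ P₂ ∧ IsHom φ Q₁ Q₂ := by
  obtain ⟨φ, ψ, hφ, hψ, hl, hr⟩ := h
  have hφP : IsHom φ P₁ P₂ := hφ.isHom
  have hψP : IsHom ψ P₂ P₁ := hψ.isHom
  -- The reverse inequality is the one for `ψ`, applied to the pullback of `X`: pulling back along
  -- `φ` and then `ψ` returns `X`.
  have hcost : ∀ X : Ω₂ →ₘ[P₂] ℝ, (C₁ : EReal) * extExpectation Q₁ (hφP.pullback X) =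
      C₂ * extExpectation Q₂ X := fun X => by
    refine le_antisymm (hφ.cost_le X) ?_
    have h1 : (C₂ : EReal) * extExpectation Q₂ (hψP.pullback (hφP.pullback X)) ≤
        C₁ * extExpectation Q₁ (hφP.pullback X) := hψ.cost_le (hφP.pullback X)
    have h2 : hψP.pullback (hφP.pullback X) = X := by
      refine AEEqFun.ext ?_
      have e1 : hψP.pullback (hφP.pullback X) =ᵐ[P₂] fun y => hφP.pullback X (ψ y) :=
        AEEqFun.coeFn_mk _ _
      have e2 : hφP.pullback X =ᵐ[P₁] fun x => X (φ x) := AEEqFun.coeFn_mk _ _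
      filter_upwards [e1, hψP.ae_comp e2, hr] with y h1 h2 h3
      rw [h1, h2]
      exact congrArg X h3
    rwa [h2] at h1
  have hind : ∀ U : Set Ω₂, MeasurableSet U → C₁ * Q₁.real (φ ⁻¹' U) = C₂ * Q₂.real U :=
    fun U hU => by
    have hm : AEStronglyMeasurable (U.indicator (1 : Ω₂ → ℝ)) P₂ :=
      (measurable_one.indicator hU).aestronglyMeasurable
    have hpre : NullMeasurableSet (φ ⁻¹' U) P₁ := hφP.nullMeasurable hU
    have e2 : extExpectation Q₂ (AEEqFun.mk _ hm) = (Q₂ U : EReal) := by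
      rw [extExpectation_congr_ae (hQ₂.ae_le (AEEqFun.coeFn_mk _ hm)),
        extExpectation_indicator hU.nullMeasurableSet]
    have e1 : extExpectation Q₁ (hφP.pullback (AEEqFun.mk _ hm)) = (Q₁ (φ ⁻¹' U) : EReal) := by
      rw [← extExpectation_indicator (hpre.mono_ac hQ₁)]
      refine extExpectation_congr_ae (hQ₁.ae_le ?_)
      filter_upwards [AEEqFun.coeFn_mk _ (hφP.aestronglyMeasurable_comp (AEEqFun.mk _ hm)),
        hφP.ae_comp (AEEqFun.coeFn_mk _ hm)] with x h1 h2
      exact h1.trans h2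
    have h := hcost (AEEqFun.mk _ hm)
    rw [e1, e2, ← ofReal_measureReal, ← ofReal_measureReal, EReal.coe_ennreal_ofReal,
      EReal.coe_ennreal_ofReal, max_eq_left measureReal_nonneg, max_eq_left measureReal_nonneg]
      at h
    exact_mod_cast h
  -- Both pricing measures have mass one, so the whole space compares the constants.
  have hC : C₁ = C₂ := by
    have h := hind univ MeasurableSet.univ
    simpa using h
  refine ⟨hC, φ, ψ, ⟨hφP, hψP, hl, hr⟩, ⟨fun s hs => (hφP.nullMeasurable hs).mono_ac hQ₁,
    fun U hU => ?_⟩⟩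
  have h := hind U hU
  rw [← hC, mul_right_inj' hC₁.ne'] at h
  exact (measureReal_eq_measureReal_iff).1 h

/-- The measures with densities `d₁` and `d₂ ∘ φ` agree on preimages under `φ`. Invertibility makes
every measurable `V` such a preimage mod 0, namely that of `ψ ⁻¹' V`. -/
theorem IsIso.density_comp_ae_eq [IsFiniteMeasure P₁] [IsFiniteMeasure P₂] [IsFiniteMeasure Q₁]
    {φ : Ω₁ → Ω₂} {ψ : Ω₂ → Ω₁} (h : IsIso φ ψ P₁ P₂) (hQ : IsHom φ Q₁ Q₂)
    {d₁ : Ω₁ → ℝ≥0∞} {d₂ : Ω₂ → ℝ≥0∞} (hd₁ : AEMeasurable d₁ P₁) (hd₂ : AEMeasurable d₂ P₂)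
    (hQ₁ : Q₁ = P₁.withDensity d₁) (hQ₂ : Q₂ = P₂.withDensity d₂) :
    d₁ =ᵐ[P₁] fun x => d₂ (φ x) := by
  have hac₂ : Q₂ ≪ P₂ := hQ₂ ▸ withDensity_absolutelyContinuous _ _
  have hfin : ∫⁻ x, d₁ x ∂P₁ ≠ ∞ := by
    rw [← setLIntegral_univ, ← withDensity_apply _ MeasurableSet.univ, ← hQ₁]
    exact measure_ne_top _ _
  refine (withDensity_eq_iff hd₁ (h.hom.aemeasurable_comp hd₂) hfin).1 (Measure.ext fun V hV => ?_)
  have hQ' : IsHom φ (P₁.withDensity fun x => d₂ (φ x)) Q₂ := by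
    rw [hQ₂]
    exact h.hom.withDensity hd₂ (Filter.Eventually.of_forall fun _ => rfl)
  have hW : NullMeasurableSet (ψ ⁻¹' V) Q₂ := (h.inv.nullMeasurable hV).mono_ac hac₂
  have hV' : V =ᵐ[P₁] φ ⁻¹' (ψ ⁻¹' V) := by
    filter_upwards [h.left_inv] with x hx
    exact propext (by change x ∈ V ↔ ψ (φ x) ∈ V; rw [hx])
  rw [measure_congr ((withDensity_absolutelyContinuous P₁ d₁).ae_le hV'),
    measure_congr ((withDensity_absolutelyContinuous P₁ fun x => d₂ (φ x)).ae_le hV'),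
    hQ'.measure_preimage₀ hW, ← hQ₁, hQ.measure_preimage₀ hW]

end Pricing

/-! ### Density laws and the tilde market -/

section CompleteMarket

instance : NullSingletonClass lebesgueIco where
  measure_singleton x := by
    rw [lebesgueIco, comap_subtype_coe_apply measurableSet_Ico, image_singleton,
      measure_singleton]

instance : StandardBorelSpace (Ico (0 : ℝ) 1) := measurableSet_Ico.standardBorel

theorem LabelledIso.congr_left {Ω₁ : Type u} {Ω₂ : Type v} [MeasurableSpace Ω₁]
    [MeasurableSpace Ω₂] {P₁ : Measure Ω₁} {P₂ : Measure Ω₂} {f₁ f₁' : Ω₁ → ℝ} {f₂ : Ω₂ → ℝ}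
    (h : LabelledIso P₁ f₁ P₂ f₂) (hf : f₁ =ᵐ[P₁] f₁') : LabelledIso P₁ f₁' P₂ f₂ := by
  obtain ⟨φ, ψ, hi, h'⟩ := h
  exact ⟨φ, ψ, hi, by filter_upwards [h', hf] with x h1 h2 using h1.trans h2⟩

variable {Ω : Type u} [MeasurableSpace Ω] {P Q : Measure Ω} [IsProbabilityMeasure P]
  [IsProbabilityMeasure Q]

instance isProbabilityMeasure_densityLaw : IsProbabilityMeasure (densityLaw P Q) :=
  Measure.isProbabilityMeasure_map (Measure.measurable_rnDeriv Q P).ennreal_toReal.aemeasurable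

omit [IsProbabilityMeasure P] [IsProbabilityMeasure Q] in
theorem withDensity_toReal_rnDeriv [SigmaFinite P] [SigmaFinite Q] (h : Q ≪ P) :
    P.withDensity (fun x => ENNReal.ofReal (Q.rnDeriv P x).toReal) = Q := by
  conv_rhs => rw [← Measure.withDensity_rnDeriv_eq Q P h]
  refine withDensity_congr_ae ?_
  filter_upwards [Q.rnDeriv_lt_top P] with x hx
  exact ENNReal.ofReal_toReal hx.ne

theorem ae_densityLaw_pos (hQP : Q ≪ P) (hPQ : P ≪ Q) : ∀ᵐ x ∂densityLaw P Q, 0 < x := by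
  refine (ae_map_iff (Measure.measurable_rnDeriv Q P).ennreal_toReal.aemeasurable
    measurableSet_Ioi).2 ?_
  filter_upwards [Q.rnDeriv_lt_top P, hPQ.ae_le (Measure.rnDeriv_pos hQP)] with x h1 h2
  exact ENNReal.toReal_pos h2.ne' h1.ne

theorem lintegral_densityLaw (hQP : Q ≪ P) : ∫⁻ x, ENNReal.ofReal x ∂densityLaw P Q = 1 := by
  rw [densityLaw, lintegral_map ENNReal.measurable_ofReal
    (Measure.measurable_rnDeriv Q P).ennreal_toReal, ← setLIntegral_univ,
    ← withDensity_apply _ MeasurableSet.univ, withDensity_toReal_rnDeriv hQP, measure_univ]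

variable (μ : Measure ℝ)

theorem aemeasurable_invCDF_Icc : AEMeasurable (invCDF μ) (volume.restrict (Icc (0 : ℝ) 1)) := by
  rw [← Measure.restrict_congr_set Ioo_ae_eq_Icc]
  exact aemeasurable_invCDF μ

theorem aemeasurable_invCDF_unitInterval : AEMeasurable (fun x : I => invCDF μ x) volume :=
  unitInterval.measurePreserving_coe.isHom.aemeasurable_comp (aemeasurable_invCDF_Icc μ)

variable [IsProbabilityMeasure μ]

theorem map_invCDF_unitInterval : (volume : Measure I).map (fun x : I => invCDF μ x) = μ := by
  refine (unitInterval.measurePreserving_coe.isHom.map_comp_eq (aemeasurable_invCDF_Icc μ)).trans ?_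
  rw [← Measure.restrict_congr_set Ioo_ae_eq_Icc]
  exact map_invCDF μ

/-- Under Lebesgue measure the quantile function has law `μ`, so it inherits positivity and mean
one. Positivity gives equivalence of the measures and lets the factor pass through positive and
negative parts. -/
theorem isCompleteWith_tildeMarket (hpos : ∀ᵐ x ∂μ, 0 < x)
    (hint : ∫⁻ x, ENNReal.ofReal x ∂μ = 1) {C : ℝ} (hC : 0 < C) :
    (tildeMarket μ C).IsCompleteWith (tildeMeasure μ) C := by
  have hm := aemeasurable_invCDF_unitInterval μ
  have hpos' : ∀ᵐ x : I, 0 < invCDF μ x := by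
    refine ae_of_ae_map hm ?_
    rwa [map_invCDF_unitInterval]
  refine ⟨⟨?_⟩, withDensity_absolutelyContinuous _ _, ?_, hC, fun X => ?_⟩
  · rw [tildeMeasure, withDensity_apply _ MeasurableSet.univ, setLIntegral_univ,
      ← lintegral_map' ENNReal.measurable_ofReal.aemeasurable hm, map_invCDF_unitInterval, hint]
  · refine withDensity_absolutelyContinuous' hm.ennreal_ofReal ?_
    filter_upwards [hpos'] with x hx
    simpa using hx
  · have hcost : extExpectation (volume : Measure I) (fun x => invCDF μ x * X x) =
        extExpectation (tildeMeasure μ) X := by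
      have key : ∀ f : I → ℝ, Measurable f → ∫⁻ x : I, ENNReal.ofReal (invCDF μ x * f x) =
          ∫⁻ x, ENNReal.ofReal (f x) ∂tildeMeasure μ := fun f hf => by
        rw [tildeMeasure, lintegral_withDensity_eq_lintegral_mul₀ hm.ennreal_ofReal
          hf.ennreal_ofReal.aemeasurable]
        refine lintegral_congr_ae ?_
        filter_upwards [hpos'] with x hx
        exact ENNReal.ofReal_mul hx.le
      refine extExpectation_eq_of_lintegral_eq (key X X.measurable) ?_
      simp only [← mul_neg]
      exact key _ X.measurable.neg
    exact congrArg (fun z => (C : EReal) * z) hcost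

theorem labelledIso_unitInterval_prod_lebesgueIco :
    LabelledIso ((volume : Measure I).prod lebesgueIco) (fun q => invCDF μ q.1)
      (μ.prod (volume.restrict (Ioo (0 : ℝ) 1))) Prod.fst := by
  have hm := aemeasurable_invCDF_unitInterval μ
  -- A measurable version is used since `invCDF` is controlled only on the open interval.
  have h := labelledIso_prod_of_standardBorel lebesgueIco volume hm.measurable_mk
  rw [← Measure.map_congr hm.ae_eq_mk, map_invCDF_unitInterval] at h
  exact h.congr_left (Measure.quasiMeasurePreserving_fst.ae hm.ae_eq_mk.symm)

omit [IsProbabilityMeasure P] [IsProbabilityMeasure Q] in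
theorem prod_lebesgueIco_eq_withDensity [SigmaFinite P] [SigmaFinite Q] (h : Q ≪ P) :
    Q.prod lebesgueIco = (P.prod lebesgueIco).withDensity
      fun q => ENNReal.ofReal (Q.rnDeriv P q.1).toReal := by
  rw [← prod_withDensity_left (Measure.measurable_rnDeriv Q P).ennreal_toReal.ennreal_ofReal,
    withDensity_toReal_rnDeriv h]

omit [IsProbabilityMeasure P] [IsProbabilityMeasure Q] in
theorem map_prod_lebesgueIco_rnDeriv :
    (P.prod lebesgueIco).map (fun q => (Q.rnDeriv P q.1).toReal) = densityLaw P Q :=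
  measurePreserving_fst.isHom.map_comp_eq
    (Measure.measurable_rnDeriv Q P).ennreal_toReal.aemeasurable

end CompleteMarket

end FinMarket

end

/-! ### The classification -/

theorem mainTheorem4 :
    (∀ (M : FinMarket.Market.{u}) (Q : Measure M.Ω) (C : ℝ),
      FinMarket.IsStandard M.P → M.IsCompleteWith Q C →
        (FinMarket.tildeMarket (FinMarket.densityLaw M.P Q) C).IsCompleteWith
            (FinMarket.tildeMeasure (FinMarket.densityLaw M.P Q)) C ∧
          FinMarket.Isomorphic (M.timesCasino Q C)
            ((FinMarket.tildeMarket (FinMarket.densityLaw M.P Q) C).timesCasino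
              (FinMarket.tildeMeasure (FinMarket.densityLaw M.P Q)) C)) ∧
    (∀ (M₁ : FinMarket.Market.{u}) (Q₁ : Measure M₁.Ω) (C₁ : ℝ)
        (M₂ : FinMarket.Market.{v}) (Q₂ : Measure M₂.Ω) (C₂ : ℝ),
      FinMarket.IsStandard M₁.P → M₁.IsCompleteWith Q₁ C₁ →
      FinMarket.IsStandard M₂.P → M₂.IsCompleteWith Q₂ C₂ →
        (FinMarket.Isomorphic (M₁.timesCasino Q₁ C₁) (M₂.timesCasino Q₂ C₂) ↔
          C₁ = C₂ ∧ FinMarket.densityLaw M₁.P Q₁ = FinMarket.densityLaw M₂.P Q₂)) := by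
  open FinMarket in
  refine ⟨fun M Q C hM hQ => ?_, fun M₁ Q₁ C₁ M₂ Q₂ C₂ hM₁ h₁ hM₂ h₂ => ⟨fun h => ?_, ?_⟩⟩
  · have := hQ.isProb
    have hcomplete := isCompleteWith_tildeMarket (densityLaw M.P Q)
      (ae_densityLaw_pos hQ.ac hQ.ac') (lintegral_densityLaw hQ.ac) hQ.pos
    have hm := (Measure.measurable_rnDeriv Q M.P).ennreal_toReal
    have hm' := aemeasurable_invCDF_unitInterval (densityLaw M.P Q)
    -- Both products have the normal form (density law) ⊗ uniform.
    refine ⟨hcomplete, ((labelledIso_prod_of_isStandard lebesgueIco hM hm).trans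
      (labelledIso_unitInterval_prod_lebesgueIco (densityLaw M.P Q)).symm).isomorphic
        (hm.comp measurable_fst).aemeasurable
        (hm'.comp_quasiMeasurePreserving Measure.quasiMeasurePreserving_fst)
        (prod_lebesgueIco_eq_withDensity hQ.ac) ?_ C⟩
    exact prod_withDensity_left₀ hm'.ennreal_ofReal
  · have := h₁.isProb
    have := h₂.isProb
    obtain ⟨hC, φ, ψ, hi, hφQ⟩ := h.exists_isIso (h₁.ac.prod .rfl) (h₂.ac.prod .rfl) h₁.pos
    refine ⟨hC, ?_⟩
    have hm₁ : Measurable fun q : M₁.Ω × Ico (0 : ℝ) 1 => Q₁.rnDeriv M₁.P q.1 :=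
      (Measure.measurable_rnDeriv Q₁ M₁.P).comp measurable_fst
    have hm₂ : Measurable fun q : M₂.Ω × Ico (0 : ℝ) 1 => Q₂.rnDeriv M₂.P q.1 :=
      (Measure.measurable_rnDeriv Q₂ M₂.P).comp measurable_fst
    have hd := hi.density_comp_ae_eq hφQ hm₁.ennreal_toReal.ennreal_ofReal.aemeasurable
      hm₂.ennreal_toReal.ennreal_ofReal.aemeasurable
      (prod_lebesgueIco_eq_withDensity h₁.ac) (prod_lebesgueIco_eq_withDensity h₂.ac)
    -- The casino factor does not change the law of the density, so laws may be compared on the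
    -- products, where `φ` lives.
    rw [← map_prod_lebesgueIco_rnDeriv, ← map_prod_lebesgueIco_rnDeriv,
      ← hi.hom.map_comp_eq hm₂.ennreal_toReal.aemeasurable]
    refine Measure.map_congr ?_
    filter_upwards [hd] with x hx
    have hx' := congrArg ENNReal.toReal hx
    rwa [ENNReal.toReal_ofReal ENNReal.toReal_nonneg,
      ENNReal.toReal_ofReal ENNReal.toReal_nonneg] at hx'
  · rintro ⟨rfl, hlaw⟩
    have := h₁.isProb
    have := h₂.isProb
    have hm₁ := (Measure.measurable_rnDeriv Q₁ M₁.P).ennreal_toReal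
    have hm₂ := (Measure.measurable_rnDeriv Q₂ M₂.P).ennreal_toReal
    have hl₁ := labelledIso_prod_of_isStandard lebesgueIco hM₁ hm₁
    have hl₂ := labelledIso_prod_of_isStandard lebesgueIco hM₂ hm₂
    change LabelledIso _ _ ((densityLaw M₁.P Q₁).prod _) _ at hl₁
    rw [hlaw] at hl₁
    exact (hl₁.trans hl₂.symm).isomorphic (hm₁.comp measurable_fst).aemeasurable
      (hm₂.comp measurable_fst).aemeasurable (prod_lebesgueIco_eq_withDensity h₁.ac)
      (prod_lebesgueIco_eq_withDensity h₂.ac) C₁
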